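/- Let $Q=\mathbb{C}^2$ be a qubit (the two-dimensional subspace of the two interfering paths) with which-path basis $Z=\{|0\rangle,|1\rangle\}$, and for $\phi\in\mathbb{R}$ let $W_\phi=\{|w_+\rangle,|w_-\rangle\}$, $|w_\pm\rangle=\frac{1}{\sqrt2}(|0\rangle\pm e^{i\phi}|1\rangle)$, be the which-phase bases, i.e. the bases in the $XY$ plane of the Bloch sphere. Let $E_1,E_2$ be arbitrary finite-dimensional quantum systems. For a classical-quantum state $\rho_{XB}=\sum_x |x\rangle\langle x|\otimes\sigma_x$ put $$H_{\min}(X|B)=-\log_2 p_{\rm guess}(X|B),\qquad p_{\rm guess}(X|B)=\max_{\{M_x\}}\sum_x \mathrm{Tr}(M_x\sigma_x),$$ the maximum being over all POVMs $\{M_x\}$ on $B$, and $$H_{\max}(X|B)=\log_2 p_{\rm secr}(X|B),\qquad p_{\rm secr}(X|B)=\max_{\tau_B}F(\rho_{XB},\mathbb{1}\otimes\tau_B)^2,$$ the maximum being over all density operators $\tau_B$ on $B$, where $F(M,N)=\|\sqrt M\sqrt N\|_1$ and $\|M\|_1=\mathrm{Tr}\sqrt{M^\dagger M}$. For a state $\rho_{QE_1E_2}$,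 the entropies $H_{\min}(Z|E_1)$ and $H_{\max}(W_\phi|E_2)$ are those of the classical-quantum states with $\sigma_x=(\langle b_x|\otimes\mathbb{1})\rho_{QE_i}(|b_x\rangle\otimes\mathbb{1})$, where $\rho_{QE_i}$ is the reduced state on $QE_i$ and $\{|b_x\rangle\}$ is the measured basis ($Z$ with $i=1$, $W_\phi$ with $i=2$). Then for every density operator $\rho_{QE_1E_2}$ on $Q\otimes E_1\otimes E_2$ the minimum of $H_{\max}(W_\phi|E_2)$ over $\phi\in\mathbb{R}$ is attained, and $$H_{\min}(Z|E_1)+\min_{\phi\in\mathbb{R}}H_{\max}(W_\phi|E_2)\ \ge\ 1 .$$ -/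

import Mathlib

open scoped Kronecker MatrixOrder ComplexOrder

noncomputable section

namespace WPDR

/-- Density operators (normalised quantum states) on the finite-dimensional space `ℂⁿ`. -/
def IsState {n : Type*} [Fintype n] (ρ : Matrix n n ℂ) : Prop :=
  ρ.PosSemidef ∧ ρ.trace = 1

/-- The trace norm `‖M‖₁ = Tr √(M† M)`. -/
def traceNorm {n : Type*} [Fintype n] [DecidableEq n] (M : Matrix n n ℂ) : ℝ :=
  (CFC.sqrt (M.conjTranspose * M)).trace.re

/-- The fidelity `F(M, N) = ‖√M √N‖₁` of two positive semidefinite operators. -/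
def fidelity {n : Type*} [Fintype n] [DecidableEq n] (M N : Matrix n n ℂ) : ℝ :=
  traceNorm (CFC.sqrt M * CFC.sqrt N)

/-- The reduced state on `Q E₁` of an operator on `Q E₁ E₂` (trace over `E₂`). -/
def traceE₂ {Q E₁ E₂ : Type*} [Fintype E₂] (ρ : Matrix (Q × E₁ × E₂) (Q × E₁ × E₂) ℂ) :
    Matrix (Q × E₁) (Q × E₁) ℂ :=
  Matrix.of fun a b => ∑ k : E₂, ρ (a.1, a.2, k) (b.1, b.2, k)

/-- The reduced state on `Q E₂` of an operator on `Q E₁ E₂` (trace over `E₁`). -/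
def traceE₁ {Q E₁ E₂ : Type*} [Fintype E₁] (ρ : Matrix (Q × E₁ × E₂) (Q × E₁ × E₂) ℂ) :
    Matrix (Q × E₂) (Q × E₂) ℂ :=
  Matrix.of fun a b => ∑ k : E₁, ρ (a.1, k, a.2) (b.1, k, b.2)

/-- Measuring `Q` in the basis `(|b_x⟩)_x` on the state `ρ` of `Q B` leaves `B` in the subnormalised
conditional states `σ_x = (⟨b_x| ⊗ 1) ρ (|b_x⟩ ⊗ 1)`, one for each outcome `x`. -/
def condStates {Q X B : Type*} [Fintype Q] (b : X → Q → ℂ) (ρ : Matrix (Q × B) (Q × B) ℂ) (x : X) :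
    Matrix B B ℂ :=
  Matrix.of fun i j => ∑ q : Q, ∑ q' : Q, star (b x q) * ρ (q, i) (q', j) * b x q'

/-- The classical-quantum operator `ρ_{XB} = ∑_x |x⟩⟨x| ⊗ σ_x`. -/
def cqState {X B : Type*} [Fintype X] [DecidableEq X] (σ : X → Matrix B B ℂ) :
    Matrix (X × B) (X × B) ℂ :=
  ∑ x : X, Matrix.single x x (1 : ℂ) ⊗ₖ σ x

/-- POVMs on `B` with outcomes in `X`. -/
def IsPOVM {X B : Type*} [Fintype X] [Fintype B] [DecidableEq B] (M : X → Matrix B B ℂ) : Prop :=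
  (∀ x, (M x).PosSemidef) ∧ ∑ x : X, M x = 1

/-- The optimal probability of guessing `X` by measuring `B`, for the classical-quantum state
`∑_x |x⟩⟨x| ⊗ σ_x`. -/
def pGuess {X B : Type*} [Fintype X] [Fintype B] [DecidableEq B] (σ : X → Matrix B B ℂ) : ℝ :=
  sSup {p : ℝ | ∃ M : X → Matrix B B ℂ, IsPOVM M ∧ p = ∑ x : X, ((M x * σ x).trace).re}

/-- The secrecy `p_secr(X|B) = max_τ F(ρ_{XB}, 1 ⊗ τ)²` over states `τ` of `B`, for the
classical-quantum state `∑_x |x⟩⟨x| ⊗ σ_x`. -/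
def pSecr {X B : Type*} [Fintype X] [DecidableEq X] [Fintype B] [DecidableEq B]
    (σ : X → Matrix B B ℂ) : ℝ :=
  sSup {p : ℝ | ∃ τ : Matrix B B ℂ, IsState τ ∧
    p = fidelity (cqState σ) ((1 : Matrix X X ℂ) ⊗ₖ τ) ^ 2}

/-- The conditional min-entropy `H_min(X|B) = -log₂ p_guess(X|B)`. -/
def hMin {X B : Type*} [Fintype X] [Fintype B] [DecidableEq B] (σ : X → Matrix B B ℂ) : ℝ :=
  -Real.logb 2 (pGuess σ)

/-- The conditional max-entropy `H_max(X|B) = log₂ p_secr(X|B)`. -/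
def hMax {X B : Type*} [Fintype X] [DecidableEq X] [Fintype B] [DecidableEq B]
    (σ : X → Matrix B B ℂ) : ℝ :=
  Real.logb 2 (pSecr σ)

/-- The which-path basis `Z = {|0⟩, |1⟩}` of the qubit. -/
def whichPath : Fin 2 → Fin 2 → ℂ :=
  ![![1, 0], ![0, 1]]

/-- The which-phase basis `W = {|w₊⟩, |w₋⟩}`, `|w_±⟩ = (|0⟩ ± exp(i φ) |1⟩) / √2`, where the
outcome `+` is labelled `0` and `-` is labelled `1`. -/
def whichPhase (φ : ℝ) : Fin 2 → Fin 2 → ℂ :=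
  ![![1 / (√2 : ℝ), Complex.exp (Complex.I * φ) / (√2 : ℝ)],
    ![1 / (√2 : ℝ), -Complex.exp (Complex.I * φ) / (√2 : ℝ)]]

end WPDR

end

noncomputable section

namespace WPDR

open Matrix

/-! ### Fidelity: continuity, the easy half of Uhlmann's theorem, an a priori bound -/

section Fidelity

variable {n m : Type*} [Fintype n] [DecidableEq n] [Fintype m]

/-! Write `ρ = K * Kᴴ`, a purification, and cut it into operators `A q` from `E₁ r` to `E₂`, one for
each path `q`. Suppose a POVM on `E₁` guesses the path with probability `p > 0`. Performing it
coherently and keeping the branch where the guess is right leaves `E₂` in a state `τ`, which serves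
as the trial state in the secrecy. The overlap of any two purifications bounds the fidelity below
(`trace_re_le_fidelity`). Since the phase basis is unbiased, the coherent guess can be combined with
its amplitudes into isometries; summing over the phase outcomes then gives an overlap of exactly `√2
* √p`. Hence `2 * p` is at most the secrecy for every `φ` (`mul_le_pSecr_of_unbiased`); a supremum
over POVMs and a logarithm give the inequality.

The minimum exists because the secrecy is a supremum over `τ` of functions continuous in `φ`, hence
lower semicontinuous, and it is periodic in `φ`, so a compact interval suffices. -/

open scoped Matrix.Norms.L2Operator in
theorem continuous_sqrt_of_nonneg {T : Type*} [TopologicalSpace T] {f : T → Matrix n n ℂ}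
    (hf : Continuous f) (hf0 : ∀ t, 0 ≤ f t) : Continuous fun t => CFC.sqrt (f t) := by
  simp only [CFC.sqrt_eq_cfc]
  exact hf.cfc_nnreal_of_mem_nhdsSet (s := Set.univ) _ (by simp) hf0
    NNReal.continuous_sqrt.continuousOn

theorem conjTranspose_sqrt (M : Matrix n n ℂ) : (CFC.sqrt M)ᴴ = CFC.sqrt M :=
  (CFC.sqrt_nonneg M).isSelfAdjoint

theorem sqrt_mul_mul_sqrt_nonneg {M : Matrix n n ℂ} (hM : 0 ≤ M) (N : Matrix n n ℂ) :
    0 ≤ CFC.sqrt N * M * CFC.sqrt N := by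
  have := (nonneg_iff_posSemidef.1 hM).conjTranspose_mul_mul_same (CFC.sqrt N)
  rw [conjTranspose_sqrt] at this
  exact nonneg_iff_posSemidef.2 this

theorem fidelity_eq_trace_sqrt {M : Matrix n n ℂ} (hM : 0 ≤ M) (N : Matrix n n ℂ) :
    fidelity M N = (CFC.sqrt (CFC.sqrt N * M * CFC.sqrt N)).trace.re := by
  unfold fidelity traceNorm
  rw [conjTranspose_mul, conjTranspose_sqrt, conjTranspose_sqrt, Matrix.mul_assoc,
    ← Matrix.mul_assoc (CFC.sqrt M), CFC.sqrt_mul_sqrt_self M hM, Matrix.mul_assoc]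

theorem continuous_fidelity {T : Type*} [TopologicalSpace T] {f g : T → Matrix n n ℂ}
    (hf : Continuous f) (hg : Continuous g) (hf0 : ∀ t, 0 ≤ f t) (hg0 : ∀ t, 0 ≤ g t) :
    Continuous fun t => fidelity (f t) (g t) := by
  have hs := continuous_sqrt_of_nonneg hg hg0
  have := continuous_sqrt_of_nonneg (hs.mul hf |>.mul hs)
    fun t => sqrt_mul_mul_sqrt_nonneg (hf0 t) (g t)
  simp only [fidelity_eq_trace_sqrt (hf0 _)]
  exact Complex.continuous_re.comp this.matrix_trace

theorem trace_re_mono {n : Type*} [Fintype n] {A B : Matrix n n ℂ} (h : A ≤ B) :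
    A.trace.re ≤ B.trace.re := by
  have := (le_iff.1 h).trace_nonneg
  rw [trace_sub, sub_nonneg] at this
  exact (Complex.le_def.1 this).1

/-- The matrix form of Young's inequality. -/
theorem two_mul_trace_re_le {Y : Matrix n n ℂ} (hY : Y.PosDef) (P R : Matrix n m ℂ) :
    2 * (Pᴴ * R).trace.re ≤ (Pᴴ * Y * P).trace.re + (Rᴴ * Y⁻¹ * R).trace.re := by
  have hdet : IsUnit Y.det := (isUnit_iff_isUnit_det Y).1 hY.isUnit
  have h := (hY.posSemidef.conjTranspose_mul_mul_same (P - Y⁻¹ * R)).trace_nonneg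
  have hYi : (Y⁻¹)ᴴ = Y⁻¹ := hY.inv.isHermitian
  have e : (P - Y⁻¹ * R)ᴴ * Y * (P - Y⁻¹ * R) =
      Pᴴ * Y * P - Pᴴ * R - (Pᴴ * R)ᴴ + Rᴴ * Y⁻¹ * R := by
    simp only [conjTranspose_sub, conjTranspose_mul, hYi, Matrix.sub_mul, Matrix.mul_sub,
      Matrix.mul_assoc, conjTranspose_conjTranspose, mul_nonsing_inv_cancel_left _ _ hdet,
      nonsing_inv_mul_cancel_left _ _ hdet]
    abel
  rw [e] at h
  have h' := (Complex.le_def.1 h).1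
  simp only [trace_add, trace_sub, trace_conjTranspose, Complex.add_re, Complex.sub_re,
    Complex.zero_re, Complex.star_def, Complex.conj_re] at h'
  linarith

theorem trace_re_conj_le {Y A : Matrix n n ℂ} {P : Matrix n m ℂ} (hY : Y.PosSemidef)
    (hA : P * Pᴴ ≤ A) : (Pᴴ * Y * P).trace.re ≤ (Y * A).trace.re := by
  obtain ⟨T, rfl⟩ := CStarAlgebra.nonneg_iff_eq_star_mul_self.1 (nonneg_iff_posSemidef.2 hY)
  have h := (le_iff.1 hA).mul_mul_conjTranspose_same T
  rw [Matrix.mul_sub, Matrix.sub_mul] at h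
  have h2 := trace_re_mono (le_iff.2 h)
  rw [trace_mul_comm, trace_mul_comm (T * A), ← Matrix.mul_assoc, ← Matrix.mul_assoc Tᴴ T A,
    ← Matrix.mul_assoc, trace_mul_comm, ← Matrix.mul_assoc] at h2
  exact h2

theorem trace_re_le_fidelity_of_posDef {M N : Matrix n n ℂ} (hM : M.PosDef) (hN : N.PosDef)
    {P R : Matrix n m ℂ} (hP : P * Pᴴ ≤ M) (hR : R * Rᴴ ≤ N) :
    (Pᴴ * R).trace.re ≤ fidelity M N := by
  rw [fidelity_eq_trace_sqrt (nonneg_iff_posSemidef.2 hM.posSemidef)]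
  have hG : (CFC.sqrt N).PosDef := isStrictlyPositive_iff_posDef.1
    (isStrictlyPositive_iff_posDef.2 hN).sqrt
  have hGG : CFC.sqrt N * CFC.sqrt N = N :=
    CFC.sqrt_mul_sqrt_self N (nonneg_iff_posSemidef.2 hN.posSemidef)
  set G := CFC.sqrt N with hGdef
  have hGH : Gᴴ = G := hG.isHermitian
  have hK : (G * M * G).PosDef := by
    have := hM.conjTranspose_mul_mul_same (B := G) (mulVec_injective_of_isUnit hG.isUnit)
    rwa [hGH] at this
  have hS : (CFC.sqrt (G * M * G)).PosDef := isStrictlyPositive_iff_posDef.1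
    (isStrictlyPositive_iff_posDef.2 hK).sqrt
  have hSS : CFC.sqrt (G * M * G) * CFC.sqrt (G * M * G) = G * M * G :=
    CFC.sqrt_mul_sqrt_self _ (nonneg_iff_posSemidef.2 hK.posSemidef)
  set S := CFC.sqrt (G * M * G) with hSdef
  have hGd : IsUnit G.det := (isUnit_iff_isUnit_det G).1 hG.isUnit
  have hSd : IsUnit S.det := (isUnit_iff_isUnit_det S).1 hS.isUnit
  -- The optimal weight in Young's inequality: with `Y = G * S⁻¹ * G`, both `Tr (Y M)` and `Tr (Y⁻¹
  -- N)` equal `Tr S`, the fidelity.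
  have hY : (G * S⁻¹ * G).PosDef := by
    have := hS.inv.conjTranspose_mul_mul_same (B := G) (mulVec_injective_of_isUnit hG.isUnit)
    rwa [hGH] at this
  have hYi : (G * S⁻¹ * G)⁻¹ = G⁻¹ * S * G⁻¹ := by
    rw [Matrix.mul_inv_rev, Matrix.mul_inv_rev, nonsing_inv_nonsing_inv _ hSd, Matrix.mul_assoc]
  have key := two_mul_trace_re_le hY P R
  have h1 := trace_re_conj_le hY.posSemidef hP
  have h2 := trace_re_conj_le hY.inv.posSemidef hR
  have e1 : (G * S⁻¹ * G * M).trace = S.trace := by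
    rw [Matrix.mul_assoc, Matrix.mul_assoc, trace_mul_comm, Matrix.mul_assoc, ← hSS,
      nonsing_inv_mul_cancel_left _ _ hSd]
  have e2 : ((G * S⁻¹ * G)⁻¹ * N).trace = S.trace := by
    rw [hYi, ← hGG, Matrix.mul_assoc, nonsing_inv_mul_cancel_left _ _ hGd, Matrix.mul_assoc,
      trace_mul_comm, Matrix.mul_assoc, mul_nonsing_inv _ hGd, Matrix.mul_one]
  rw [e1] at h1
  rw [e2] at h2
  linarith

theorem add_sq_smul_one_posDef {n : Type*} [DecidableEq n] {M : Matrix n n ℂ} (hM : 0 ≤ M)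
    {ε : ℝ} (hε : ε ≠ 0) :
    (M + ((ε ^ 2 : ℝ) : ℂ) • 1).PosDef :=
  (PosDef.one.smul (by exact_mod_cast (by positivity : 0 < ε ^ 2))).posSemidef_add
    (nonneg_iff_posSemidef.1 hM)

/-- The easy half of Uhlmann's theorem. -/
theorem trace_re_le_fidelity (P R : Matrix n m ℂ) :
    (Pᴴ * R).trace.re ≤ fidelity (P * Pᴴ) (R * Rᴴ) := by
  have nn : ∀ P : Matrix n m ℂ, 0 ≤ P * Pᴴ := fun P =>
    nonneg_iff_posSemidef.2 (posSemidef_self_mul_conjTranspose P)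
  -- Perturbing by `ε ^ 2` keeps positivity for every real `ε`, so the fidelity is continuous on the
  -- whole line, and gives definiteness off `0`.
  have one : ∀ ε : ℝ, (0 : Matrix n n ℂ) ≤ ((ε ^ 2 : ℝ) : ℂ) • 1 := fun ε =>
    nonneg_iff_posSemidef.2 (PosSemidef.one.smul (by exact_mod_cast sq_nonneg ε))
  have hc : Continuous fun ε : ℝ => fidelity (P * Pᴴ + ((ε ^ 2 : ℝ) : ℂ) • 1)
      (R * Rᴴ + ((ε ^ 2 : ℝ) : ℂ) • 1) :=
    continuous_fidelity (by fun_prop) (by fun_prop) (fun ε => add_nonneg (nn P) (one ε))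
      (fun ε => add_nonneg (nn R) (one ε))
  have ht := (hc.tendsto 0).mono_left (nhdsWithin_le_nhds (s := {0}ᶜ))
  simp only [ne_eq, OfNat.ofNat_ne_zero, not_false_eq_true, zero_pow, Complex.ofReal_zero,
    zero_smul, add_zero] at ht
  refine ge_of_tendsto ht ?_
  filter_upwards [self_mem_nhdsWithin] with ε hε
  exact trace_re_le_fidelity_of_posDef (add_sq_smul_one_posDef (nn P) hε)
    (add_sq_smul_one_posDef (nn R) hε) (le_add_of_nonneg_right (one ε))
    (le_add_of_nonneg_right (one ε))

theorem fidelity_nonneg (M N : Matrix n n ℂ) : 0 ≤ fidelity M N :=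
  (Complex.le_def.1 (nonneg_iff_posSemidef.1 (CFC.sqrt_nonneg _)).trace_nonneg).1

-- Makes the secrecy a supremum of a bounded set. It rests on `2√x ≤ x + 1`, traced, with `x`
-- replaced by `√N M √N`.
open scoped Matrix.Norms.L2Operator in
theorem exists_fidelity_le {M : Matrix n n ℂ} (hM : 0 ≤ M) :
    ∃ c : ℝ, ∀ N : Matrix n n ℂ, 0 ≤ N → fidelity M N ≤ Fintype.card n + c * N.trace.re := by
  refine ⟨‖M‖, fun N hN => ?_⟩
  rw [fidelity_eq_trace_sqrt hM]
  have hX := sqrt_mul_mul_sqrt_nonneg hM N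
  have h1 : (CFC.sqrt N * M * CFC.sqrt N).trace.re ≤ ‖M‖ * N.trace.re := by
    have h := (IsSelfAdjoint.le_algebraMap_norm_self hM.isSelfAdjoint)
    have h' := (le_iff.1 h).conjTranspose_mul_mul_same (CFC.sqrt N)
    rw [Matrix.mul_sub, Matrix.sub_mul, conjTranspose_sqrt] at h'
    refine (trace_re_mono (le_iff.2 h')).trans_eq ?_
    rw [Algebra.algebraMap_eq_smul_one, Matrix.mul_smul, Matrix.smul_mul, Matrix.mul_one,
      CFC.sqrt_mul_sqrt_self N hN, trace_smul, Complex.smul_re, smul_eq_mul]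
  set X := CFC.sqrt N * M * CFC.sqrt N
  have h2 := (posSemidef_conjTranspose_mul_self (CFC.sqrt X - 1)).trace_nonneg
  have e : (CFC.sqrt X - 1)ᴴ * (CFC.sqrt X - 1) = X - CFC.sqrt X - CFC.sqrt X + 1 := by
    rw [conjTranspose_sub, conjTranspose_sqrt, conjTranspose_one, Matrix.sub_mul, Matrix.mul_sub,
      CFC.sqrt_mul_sqrt_self X hX, Matrix.mul_one, Matrix.one_mul]
    abel
  rw [e] at h2
  have h3 := (Complex.le_def.1 h2).1
  have h4 := (Complex.le_def.1 (nonneg_iff_posSemidef.1 (CFC.sqrt_nonneg X)).trace_nonneg).1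
  simp at h3 h4
  linarith

end Fidelity

/-! ### Block diagonal form of classical-quantum operators -/

section BlockDiagonal

variable {X l m n : Type*} [Fintype X] [DecidableEq X]

/-- The block diagonal matrix `∑ x, |x⟩⟨x| ⊗ G x` with rectangular blocks. -/
def blockDiag (G : X → Matrix l m ℂ) : Matrix (X × l) (X × m) ℂ :=
  ∑ x : X, Matrix.single x x (1 : ℂ) ⊗ₖ G x

theorem blockDiag_apply (G : X → Matrix l m ℂ) (x y : X) (i : l) (j : m) :
    blockDiag G (x, i) (y, j) = if x = y then G x i j else 0 := by
  simp only [blockDiag, Matrix.sum_apply, kroneckerMap_apply, Matrix.single_apply]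
  rw [Finset.sum_eq_single x (by simp +contextual) (by simp)]
  simp

theorem blockDiag_mul [Fintype m] (G : X → Matrix l m ℂ) (H : X → Matrix m n ℂ) :
    blockDiag G * blockDiag H = blockDiag fun x => G x * H x := by
  ext ⟨x, i⟩ ⟨y, j⟩
  simp only [Matrix.mul_apply, Fintype.sum_prod_type, blockDiag_apply]
  rw [Finset.sum_eq_single x (by simp +contextual [eq_comm]) (by simp)]
  by_cases h : x = y <;> simp [h]

theorem blockDiag_conjTranspose (G : X → Matrix l m ℂ) :
    (blockDiag G)ᴴ = blockDiag fun x => (G x)ᴴ := by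
  ext ⟨x, i⟩ ⟨y, j⟩
  simp only [conjTranspose_apply, blockDiag_apply]
  by_cases h : x = y
  · subst h; simp
  · simp [h, Ne.symm h]

theorem trace_blockDiag [Fintype m] (G : X → Matrix m m ℂ) :
    (blockDiag G).trace = ∑ x, (G x).trace := by
  simp [trace, Fintype.sum_prod_type, blockDiag_apply]

theorem one_kronecker_eq_blockDiag (τ : Matrix m m ℂ) :
    (1 : Matrix X X ℂ) ⊗ₖ τ = blockDiag fun _ => τ := by
  ext ⟨x, i⟩ ⟨y, j⟩
  simp [blockDiag_apply, Matrix.one_apply]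

theorem cqState_mul_conjTranspose [Fintype m] (G : X → Matrix l m ℂ) :
    cqState (fun x => G x * (G x)ᴴ) = blockDiag G * (blockDiag G)ᴴ := by
  rw [blockDiag_conjTranspose, blockDiag_mul]
  rfl

theorem cqState_nonneg [Fintype l] [DecidableEq l] {σ : X → Matrix l l ℂ}
    (hσ : ∀ x, (σ x).PosSemidef) : 0 ≤ cqState σ := by
  have h : ∀ x, ∃ G : Matrix l l ℂ, σ x = G * Gᴴ := fun x =>
    ⟨CFC.sqrt (σ x), by
      rw [conjTranspose_sqrt, CFC.sqrt_mul_sqrt_self _ (nonneg_iff_posSemidef.2 (hσ x))]⟩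
  choose G hG using h
  obtain rfl : σ = _ := funext hG
  rw [cqState_mul_conjTranspose]
  exact nonneg_iff_posSemidef.2 (posSemidef_self_mul_conjTranspose _)

end BlockDiagonal

/-! ### Secrecy: boundedness, semicontinuity, lower bound from a guess -/

section Secrecy

variable {X B : Type*} [Fintype X] [DecidableEq X] [Fintype B] [DecidableEq B]

theorem IsState.one_kronecker_nonneg {X B : Type*} [Finite X] [DecidableEq X] [Fintype B]
    {τ : Matrix B B ℂ} (hτ : IsState τ) :
    0 ≤ (1 : Matrix X X ℂ) ⊗ₖ τ :=
  nonneg_iff_posSemidef.2 (PosSemidef.one.kronecker hτ.1)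

theorem bddAbove_secr {σ : X → Matrix B B ℂ} (hσ : ∀ x, (σ x).PosSemidef) :
    BddAbove {p : ℝ | ∃ τ : Matrix B B ℂ, IsState τ ∧
      p = fidelity (cqState σ) ((1 : Matrix X X ℂ) ⊗ₖ τ) ^ 2} := by
  obtain ⟨c, hc⟩ := exists_fidelity_le (cqState_nonneg hσ)
  refine ⟨(Fintype.card (X × B) + c * Fintype.card X) ^ 2, ?_⟩
  rintro p ⟨τ, hτ, rfl⟩
  have h := hc _ (hτ.one_kronecker_nonneg (X := X))
  rw [trace_kronecker, hτ.2, trace_one, mul_one, Complex.natCast_re] at h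
  exact pow_le_pow_left₀ (fidelity_nonneg _ _) h 2

theorem sq_fidelity_le_pSecr {σ : X → Matrix B B ℂ} (hσ : ∀ x, (σ x).PosSemidef)
    {τ : Matrix B B ℂ} (hτ : IsState τ) :
    fidelity (cqState σ) ((1 : Matrix X X ℂ) ⊗ₖ τ) ^ 2 ≤ pSecr σ :=
  le_csSup (bddAbove_secr hσ) ⟨τ, hτ, rfl⟩

/-- A trial state `τ` that beats `y` at `t` still beats it nearby, by continuity of the fidelity for
fixed `τ`. -/
theorem lowerSemicontinuous_pSecr {T : Type*} [TopologicalSpace T] {σ : T → X → Matrix B B ℂ}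
    (hσ : ∀ t x, (σ t x).PosSemidef) (hc : ∀ x, Continuous fun t => σ t x)
    (hB : ∃ τ : Matrix B B ℂ, IsState τ) : LowerSemicontinuous fun t => pSecr (σ t) := by
  intro t y hy
  obtain ⟨τ₀, hτ₀⟩ := hB
  obtain ⟨_, ⟨τ, hτ, rfl⟩, hlt⟩ := exists_lt_of_lt_csSup (by exact ⟨_, τ₀, hτ₀, rfl⟩) hy
  have hcq : Continuous fun t => cqState (σ t) := by
    refine continuous_matrix fun a b => ?_
    have h : ∀ t, cqState (σ t) a b = if a.1 = b.1 then σ t a.1 a.2 b.2 else 0 :=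
      fun t => blockDiag_apply (σ t) a.1 b.1 a.2 b.2
    simp only [h]
    split_ifs
    · exact (hc a.1).matrix_elem _ _
    · exact continuous_const
  have hF := (continuous_fidelity hcq (continuous_const (y := (1 : Matrix X X ℂ) ⊗ₖ τ))
    (fun t => cqState_nonneg (hσ t)) (fun _ => hτ.one_kronecker_nonneg)).pow 2
  filter_upwards [hF.continuousAt.eventually_const_lt hlt] with s hs
  exact hs.trans_le (sq_fidelity_le_pSecr (hσ s) hτ)

/-- Let `∑ q, |q⟩ ⊗ A q` be a pure state, `A q` being seen as an operator between the two other
systems, and `(b w)` a basis unbiased to the standard one. If `D qᴴ * D q` is a POVM that guesses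
`q` with success probability `p`, then `c * p` is a lower bound for the secrecy of the
outcome `w`. -/
theorem mul_le_pSecr_of_unbiased {Q m : Type*} [Fintype Q] [DecidableEq Q] [Fintype m]
    [DecidableEq m] (A : Q → Matrix B m ℂ) (D : Q → Matrix m m ℂ)
    (hD : ∑ q, (D q)ᴴ * D q = 1) {b : X → Q → ℂ}
    (hb : ∀ q q', ∑ w, star (b w q) * b w q' = if q = q' then 1 else 0) {c : ℝ} (hc : 0 < c)
    (hbc : ∀ w q, b w q * star (b w q) = (c : ℂ)⁻¹) {σ : X → Matrix B B ℂ}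
    (hσ : ∀ w, σ w = (∑ q, star (b w q) • A q) * (∑ q, star (b w q) • A q)ᴴ) {p : ℝ}
    (hp : 0 < p) (hpA : ∑ q, (A q * ((D q)ᴴ * D q) * (A q)ᴴ).trace = p) :
    c * p ≤ pSecr σ := by
  -- The unnormalised branch in which the coherent guess is right, with the guess `q` kept in a
  -- register; `C * Cᴴ` has trace `p`.
  let C : Matrix B (Q × m) ℂ := of fun k s => (A s.1 * (D s.1)ᴴ) k s.2
  -- The coherent guess weighted by the conjugate amplitudes of `b w`. Unbiasedness makes it an
  -- isometry, so `Bw w * (V w)ᴴ` still purifies `σ w`.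
  let V : X → Matrix (Q × m) m ℂ := fun w =>
    of fun s t => ((√c : ℝ) : ℂ) * star (b w s.1) * D s.1 s.2 t
  let Bw : X → Matrix B m ℂ := fun w => ∑ q, star (b w q) • A q
  have hsc : ((√c : ℝ) : ℂ) * (√c : ℝ) = c := by
    rw [← Complex.ofReal_mul, Real.mul_self_sqrt hc.le]
  have hcC : (c : ℂ) ≠ 0 := by exact_mod_cast hc.ne'
  have hV : ∀ w, (V w)ᴴ * V w = 1 := by
    intro w
    rw [← hD]
    ext i j
    simp only [V, Matrix.mul_apply, conjTranspose_apply, of_apply, Fintype.sum_prod_type,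
      Matrix.sum_apply]
    refine Finset.sum_congr rfl fun q _ => Finset.sum_congr rfl fun s _ => ?_
    have h := hbc w q
    simp only [star_mul', Complex.star_def, Complex.conj_ofReal, Complex.conj_conj] at h ⊢
    calc _ = (((√c : ℝ) : ℂ) * (√c : ℝ)) * (b w q * (starRingEnd ℂ) (b w q)) *
          ((starRingEnd ℂ) (D q s i) * D q s j) := by ring
      _ = _ := by rw [hsc, h, mul_inv_cancel₀ hcC, one_mul]
  have hCC : (C * Cᴴ).trace = p := by
    rw [← hpA]
    have : C * Cᴴ = ∑ q, A q * ((D q)ᴴ * D q) * (A q)ᴴ := by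
      have e : ∀ q, A q * ((D q)ᴴ * D q) * (A q)ᴴ = (A q * (D q)ᴴ) * (A q * (D q)ᴴ)ᴴ := by
        intro q
        simp only [conjTranspose_mul, conjTranspose_conjTranspose, Matrix.mul_assoc]
      simp only [e]
      ext i j
      simp only [C, Matrix.mul_apply (M := of _), Fintype.sum_prod_type, Matrix.sum_apply,
        conjTranspose_apply, of_apply]
      refine Finset.sum_congr rfl fun q _ => ?_
      rw [Matrix.mul_apply (M := A q * (D q)ᴴ)]
      rfl
    rw [this, trace_sum]
  have hCV : ∀ w, C * V w = ∑ q, (((√c : ℝ) : ℂ) * star (b w q)) • (A q * ((D q)ᴴ * D q)) := by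
    intro w
    ext i j
    simp only [C, V, Matrix.mul_apply (M := of _), Fintype.sum_prod_type, Matrix.sum_apply,
      of_apply, Matrix.smul_apply]
    refine Finset.sum_congr rfl fun q _ => ?_
    rw [← Matrix.mul_assoc, Matrix.mul_apply (M := A q * (D q)ᴴ), smul_eq_mul, Finset.mul_sum]
    exact Finset.sum_congr rfl fun s _ => by ring
  -- Completeness of the basis recovers `A q` from the outcomes `w`, which turns the overlap into
  -- the guessing probability.
  have hBA : ∀ q, ∑ w, star (b w q) • (Bw w)ᴴ = (A q)ᴴ := by
    intro q
    simp only [Bw, conjTranspose_sum, conjTranspose_smul, star_star, Finset.smul_sum, smul_smul]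
    rw [Finset.sum_comm]
    simp only [← Finset.sum_smul, hb, ite_smul, one_smul, zero_smul, Finset.sum_ite_eq,
      Finset.mem_univ, if_true]
  have htr : ∑ w, ((Bw w * (V w)ᴴ)ᴴ * C).trace = ((√c * p : ℝ) : ℂ) := by
    calc ∑ w, ((Bw w * (V w)ᴴ)ᴴ * C).trace
        = ∑ w, ((Bw w)ᴴ * (C * V w)).trace := by
          refine Finset.sum_congr rfl fun w _ => ?_
          rw [conjTranspose_mul, conjTranspose_conjTranspose, Matrix.mul_assoc, trace_mul_comm,
            Matrix.mul_assoc]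
      _ = ∑ q, ((√c : ℝ) : ℂ) *
            ((∑ w, star (b w q) • (Bw w)ᴴ) * (A q * ((D q)ᴴ * D q))).trace := by
          simp only [hCV, Matrix.mul_sum, trace_sum, Matrix.sum_mul, Finset.mul_sum,
            Matrix.mul_smul, Matrix.smul_mul, trace_smul, smul_eq_mul, mul_assoc]
          exact Finset.sum_comm
      _ = _ := by
          simp only [hBA]
          rw [← Finset.mul_sum, Complex.ofReal_mul, ← hpA]
          congr 1
          exact Finset.sum_congr rfl fun q _ => trace_mul_comm _ _
  have hsp : (0 : ℝ) < √p := Real.sqrt_pos.2 hp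
  let R : Matrix B (Q × m) ℂ := (((√p)⁻¹ : ℝ) : ℂ) • C
  have hR : R * Rᴴ = ((p⁻¹ : ℝ) : ℂ) • (C * Cᴴ) := by
    simp only [R, conjTranspose_smul, Matrix.smul_mul, Matrix.mul_smul, smul_smul,
      Complex.star_def, Complex.conj_ofReal]
    rw [← Complex.ofReal_mul, ← mul_inv, Real.mul_self_sqrt hp.le]
  have hτ : IsState (R * Rᴴ) := by
    refine ⟨posSemidef_self_mul_conjTranspose R, ?_⟩
    rw [hR, trace_smul, hCC, smul_eq_mul, ← Complex.ofReal_mul, inv_mul_cancel₀ hp.ne',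
      Complex.ofReal_one]
  have hσ' : σ = fun w => (Bw w * (V w)ᴴ) * (Bw w * (V w)ᴴ)ᴴ := by
    funext w
    rw [hσ w, conjTranspose_mul, conjTranspose_conjTranspose, Matrix.mul_assoc,
      ← Matrix.mul_assoc (V w)ᴴ, hV, Matrix.one_mul]
  have hF := trace_re_le_fidelity (blockDiag fun w => Bw w * (V w)ᴴ) (blockDiag fun _ : X => R)
  rw [← cqState_mul_conjTranspose, ← hσ', blockDiag_conjTranspose, blockDiag_conjTranspose,
    blockDiag_mul, blockDiag_mul, ← one_kronecker_eq_blockDiag, trace_blockDiag] at hF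
  have hval : (∑ w, ((Bw w * (V w)ᴴ)ᴴ * R).trace).re = √c * √p := by
    simp only [R, Matrix.mul_smul, trace_smul, ← Finset.smul_sum, htr]
    rw [smul_eq_mul, ← Complex.ofReal_mul, Complex.ofReal_re]
    field_simp
    rw [Real.sq_sqrt hp.le]
  rw [hval] at hF
  have hσp : ∀ w, (σ w).PosSemidef := fun w => by
    rw [hσ w]; exact posSemidef_self_mul_conjTranspose _
  refine le_trans ?_ (sq_fidelity_le_pSecr hσp hτ)
  refine le_trans (le_of_eq ?_) (pow_le_pow_left₀ (by positivity) hF 2)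
  rw [mul_pow, Real.sq_sqrt hc.le, Real.sq_sqrt hp.le]

end Secrecy

/-! ### Conditional states expressed through a purification -/

section Purification

variable {Q E₁ E₂ r : Type*} [Fintype Q] [Fintype E₁] [Fintype r]

/-- The pure state with amplitudes `K` on `Q E₁ E₂ r`, cut into operators from `E₁ r` to `E₂`,
one for each basis state of `Q`. -/
def amplitudes (K : Matrix (Q × E₁ × E₂) r ℂ) (q : Q) : Matrix E₂ (E₁ × r) ℂ :=
  of fun k s => K (q, s.1, k) s.2

theorem condStates_traceE₁ {X : Type*} (b : X → Q → ℂ) (K : Matrix (Q × E₁ × E₂) r ℂ) (w : X) :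
    condStates b (traceE₁ (K * Kᴴ)) w =
      (∑ q, star (b w q) • amplitudes K q) * (∑ q, star (b w q) • amplitudes K q)ᴴ := by
  ext i j
  simp only [conjTranspose_sum, conjTranspose_smul, star_star, Matrix.sum_mul, Matrix.mul_sum,
    Matrix.smul_mul, Matrix.mul_smul, Matrix.sum_apply, Matrix.smul_apply, smul_eq_mul, Finset.mul_sum]
  rw [Finset.sum_comm]
  simp only [condStates, of_apply]
  refine Finset.sum_congr rfl fun q _ => Finset.sum_congr rfl fun q' _ => ?_
  have h : traceE₁ (K * Kᴴ) (q, i) (q', j) = (amplitudes K q * (amplitudes K q')ᴴ) i j := by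
    simp [traceE₁, amplitudes, Matrix.mul_apply, Fintype.sum_prod_type]
  rw [h]
  ring

theorem condStates_whichPath {B : Type*} (ρ : Matrix (Fin 2 × B) (Fin 2 × B) ℂ) (x : Fin 2) :
    condStates whichPath ρ x = of fun i j => ρ (x, i) (x, j) := by
  ext i j
  fin_cases x <;> simp [condStates, whichPath]

/-- The transpose appears because `E₁` is an input index of `amplitudes K x`, while `M` acts on it
as a ket. -/
theorem trace_mul_condStates_whichPath [Fintype E₂] [DecidableEq r] (K : Matrix (Fin 2 × E₁ × E₂) r ℂ)
    (M : Matrix E₁ E₁ ℂ) (x : Fin 2) :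
    (M * condStates whichPath (traceE₂ (K * Kᴴ)) x).trace =
      (amplitudes K x * (Mᵀ ⊗ₖ (1 : Matrix r r ℂ)) * (amplitudes K x)ᴴ).trace := by
  have h : condStates whichPath (traceE₂ (K * Kᴴ)) x =
      of fun i j => ∑ s, ((amplitudes K x)ᴴ * amplitudes K x) (j, s) (i, s) := by
    ext i j
    simp only [condStates_whichPath, traceE₂, amplitudes, Matrix.mul_apply, of_apply,
      conjTranspose_apply]
    rw [Finset.sum_comm]
    exact Finset.sum_congr rfl fun s _ => Finset.sum_congr rfl fun k _ => mul_comm _ _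
  rw [h, trace_mul_comm _ (amplitudes K x)ᴴ, ← Matrix.mul_assoc]
  generalize (amplitudes K x)ᴴ * amplitudes K x = Z
  simp only [trace, diag_apply, Matrix.mul_apply, of_apply, Fintype.sum_prod_type,
    kroneckerMap_apply, transpose_apply, Matrix.one_apply, mul_ite, mul_one, mul_zero,
    Finset.sum_ite_eq', Finset.mem_univ, if_true]
  refine Finset.sum_congr rfl fun i _ => ?_
  rw [Finset.sum_comm]
  refine Finset.sum_congr rfl fun j _ => ?_
  rw [Finset.mul_sum]
  exact Finset.sum_congr rfl fun s _ => mul_comm _ _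

theorem condStates_traceE₁_posSemidef [Fintype E₂] [DecidableEq Q] [DecidableEq E₁] [DecidableEq E₂]
    {X : Type*} (b : X → Q → ℂ)
    {ρ : Matrix (Q × E₁ × E₂) (Q × E₁ × E₂) ℂ} (hρ : ρ.PosSemidef) (w : X) :
    (condStates b (traceE₁ ρ) w).PosSemidef := by
  have hK : ρ = CFC.sqrt ρ * (CFC.sqrt ρ)ᴴ := by
    rw [conjTranspose_sqrt, CFC.sqrt_mul_sqrt_self _ (nonneg_iff_posSemidef.2 hρ)]
  rw [hK, condStates_traceE₁]
  exact posSemidef_self_mul_conjTranspose _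

end Purification

/-! ### The which-phase bases: unbiasedness, orthonormality, periodicity -/

section WhichPhase

theorem ofReal_sqrt_two_mul_self : ((√2 : ℝ) : ℂ) * (√2 : ℝ) = 2 := by
  rw [← Complex.ofReal_mul, Real.mul_self_sqrt (by norm_num)]; norm_num

theorem exp_mul_star_exp (φ : ℝ) :
    Complex.exp (Complex.I * φ) * (starRingEnd ℂ) (Complex.exp (Complex.I * φ)) = 1 := by
  rw [← Complex.exp_conj, ← Complex.exp_add]
  simp

theorem whichPhase_mul_star (φ : ℝ) (w q : Fin 2) :
    whichPhase φ w q * star (whichPhase φ w q) = ((2 : ℝ) : ℂ)⁻¹ := by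
  have h1 := ofReal_sqrt_two_mul_self
  have h2 := exp_mul_star_exp φ
  fin_cases w <;> fin_cases q <;>
    simp [whichPhase, div_mul_div_comm, h1, h2, ← mul_inv]

theorem sum_star_whichPhase_mul (φ : ℝ) (q q' : Fin 2) :
    ∑ w, star (whichPhase φ w q) * whichPhase φ w q' = if q = q' then 1 else 0 := by
  by_cases h : q = q'
  · subst h
    simp only [mul_comm (star _), whichPhase_mul_star]
    norm_num
  · rw [if_neg h, Fin.sum_univ_two]
    fin_cases q <;> fin_cases q' <;> first
      | exact absurd rfl h
      | (simp [whichPhase]; ring)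

theorem whichPhase_periodic : Function.Periodic whichPhase (2 * Real.pi) := by
  intro φ
  have : Complex.exp (Complex.I * ((φ + 2 * Real.pi : ℝ) : ℂ)) = Complex.exp (Complex.I * φ) := by
    rw [mul_comm, mul_comm Complex.I]
    push_cast
    rw [add_mul, Complex.exp_periodic]
  simp only [whichPhase, this]

theorem continuous_whichPhase (w q : Fin 2) : Continuous fun φ => whichPhase φ w q := by
  fin_cases w <;> fin_cases q <;> simp [whichPhase] <;> fun_prop

end WhichPhase

/-! ### The uncertainty relation and the minimum over phases -/

section Uncertainty

variable {E₁ E₂ : Type*} [Fintype E₁] [DecidableEq E₁] [Fintype E₂] [DecidableEq E₂]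
  {ρ : Matrix (Fin 2 × E₁ × E₂) (Fin 2 × E₁ × E₂) ℂ}

theorem pSecr_nonneg {X B : Type*} [Fintype X] [DecidableEq X] [Fintype B] [DecidableEq B]
    (σ : X → Matrix B B ℂ) : 0 ≤ pSecr σ :=
  Real.sSup_nonneg (by rintro _ ⟨τ, -, rfl⟩; positivity)

theorem two_mul_guess_le_pSecr (hρ : ρ.PosSemidef) (φ : ℝ) {M : Fin 2 → Matrix E₁ E₁ ℂ}
    (hM : IsPOVM M) :
    2 * ∑ x, (M x * condStates whichPath (traceE₂ ρ) x).trace.re ≤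
      pSecr (condStates (whichPhase φ) (traceE₁ ρ)) := by
  obtain ⟨K, hK⟩ : ∃ K : Matrix (Fin 2 × E₁ × E₂) (Fin 2 × E₁ × E₂) ℂ, ρ = K * Kᴴ :=
    ⟨CFC.sqrt ρ, by
      rw [conjTranspose_sqrt, CFC.sqrt_mul_sqrt_self _ (nonneg_iff_posSemidef.2 hρ)]⟩
  rw [← Complex.re_sum]
  set z := ∑ x, (M x * condStates whichPath (traceE₂ ρ) x).trace with hz
  -- The general bound normalises the trial state by `p`, so it needs `p > 0`.
  rcases le_or_gt z.re 0 with h | h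
  · linarith [pSecr_nonneg (condStates (whichPhase φ) (traceE₁ ρ))]
  choose T hT using fun x => CStarAlgebra.nonneg_iff_eq_star_mul_self.1
    (nonneg_iff_posSemidef.2 (hM.1 x).transpose)
  let D : Fin 2 → Matrix (E₁ × (Fin 2 × E₁ × E₂)) (E₁ × (Fin 2 × E₁ × E₂)) ℂ := fun x => T x ⊗ₖ 1
  have hDD : ∀ x, (D x)ᴴ * D x = (M x)ᵀ ⊗ₖ 1 := fun x => by
    rw [conjTranspose_kronecker, ← mul_kronecker_mul, conjTranspose_one, Matrix.one_mul,
      ← star_eq_conjTranspose, ← hT x]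
  have hD : ∑ x, (D x)ᴴ * D x = 1 := by
    simp only [hDD]
    have : ∑ x, (M x)ᵀ = 1 := by rw [← transpose_sum, hM.2, transpose_one]
    rw [Fin.sum_univ_two] at this ⊢
    rw [← add_kronecker, this, one_kronecker_one]
  have hzA : z = ∑ x, (amplitudes K x * ((D x)ᴴ * D x) * (amplitudes K x)ᴴ).trace := by
    rw [hz, hK]
    exact Finset.sum_congr rfl fun x _ => by rw [trace_mul_condStates_whichPath, hDD]
  have hz0 : 0 ≤ z := by
    rw [hzA]
    exact Finset.sum_nonneg fun x _ =>
      ((posSemidef_conjTranspose_mul_self (D x)).mul_mul_conjTranspose_same _).trace_nonneg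
  refine mul_le_pSecr_of_unbiased (amplitudes K) D hD (sum_star_whichPhase_mul φ) two_pos
    (whichPhase_mul_star φ) (fun w => by rw [hK, condStates_traceE₁]) h ?_
  rw [← hzA]
  exact Complex.ext rfl (Complex.le_def.1 hz0).2.symm

/-- The uncertainty relation between guessing the path and the secrecy of the phase. -/
theorem two_mul_pGuess_le_pSecr (hρ : ρ.PosSemidef) (φ : ℝ) :
    2 * pGuess (condStates whichPath (traceE₂ ρ)) ≤
      pSecr (condStates (whichPhase φ) (traceE₁ ρ)) := by
  have : pGuess (condStates whichPath (traceE₂ ρ)) ≤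
      pSecr (condStates (whichPhase φ) (traceE₁ ρ)) / 2 := by
    refine csSup_le ⟨_, ![1, 0], ⟨fun x => ?_, by simp⟩, rfl⟩ ?_
    · fin_cases x
      · exact PosSemidef.one
      · exact PosSemidef.zero
    · rintro _ ⟨M, hM, rfl⟩
      linarith [two_mul_guess_le_pSecr hρ φ hM]
  linarith

theorem sum_trace_condStates_whichPath {E₁ E₂ : Type*} [Fintype E₁] [Fintype E₂]
    (ρ : Matrix (Fin 2 × E₁ × E₂) (Fin 2 × E₁ × E₂) ℂ) :
    ∑ x, (condStates whichPath (traceE₂ ρ) x).trace = ρ.trace := by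
  simp [condStates_whichPath, traceE₂, trace, Fintype.sum_prod_type]

/-- A uniformly random guess succeeds with probability `1/2`; the uncertainty relation itself bounds
the set of success probabilities. -/
theorem pGuess_pos (hρ : IsState ρ) : 0 < pGuess (condStates whichPath (traceE₂ ρ)) := by
  refine lt_of_lt_of_le (b := (2⁻¹ : ℝ)) (by norm_num) (le_csSup ?_ ?_)
  · refine ⟨pSecr (condStates (whichPhase 0) (traceE₁ ρ)) / 2, ?_⟩
    rintro _ ⟨M, hM, rfl⟩
    linarith [two_mul_guess_le_pSecr hρ.1 0 hM]
  · refine ⟨fun _ => (2⁻¹ : ℂ) • 1, ⟨fun _ => PosSemidef.one.smul ?_, ?_⟩, ?_⟩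
    · exact inv_nonneg.2 zero_le_two
    · rw [Fin.sum_univ_two, ← add_smul]; norm_num
    · have h := sum_trace_condStates_whichPath ρ
      rw [hρ.2] at h
      simp only [Matrix.smul_mul, Matrix.one_mul, trace_smul]
      rw [← Complex.re_sum, ← Finset.smul_sum, h]
      norm_num

theorem exists_isState [Nonempty E₂] : ∃ τ : Matrix E₂ E₂ ℂ, IsState τ := by
  obtain ⟨k⟩ := ‹Nonempty E₂›
  refine ⟨Matrix.single k k 1, ?_, by simp⟩
  rw [← Matrix.diagonal_single]
  exact PosSemidef.diagonal (Pi.single_nonneg.2 zero_le_one)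

theorem exists_forall_pSecr_le (hρ : IsState ρ) :
    ∃ φ₀, ∀ φ, pSecr (condStates (whichPhase φ₀) (traceE₁ ρ)) ≤
      pSecr (condStates (whichPhase φ) (traceE₁ ρ)) := by
  have hE : Nonempty E₂ := by
    by_contra h
    rw [not_nonempty_iff] at h
    have := hρ.2
    simp [trace] at this
  have hl : LowerSemicontinuous fun φ => pSecr (condStates (whichPhase φ) (traceE₁ ρ)) := by
    refine lowerSemicontinuous_pSecr (fun φ => condStates_traceE₁_posSemidef _ hρ.1) (fun w => ?_)
      exists_isState
    refine continuous_matrix fun i j => ?_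
    simp only [condStates, of_apply]
    exact continuous_finsetSum _ fun q _ => continuous_finsetSum _ fun q' _ =>
      ((continuous_whichPhase w q).star.mul continuous_const).mul (continuous_whichPhase w q')
  obtain ⟨φ₀, -, hφ₀⟩ := (hl.lowerSemicontinuousOn (Set.Icc 0 (2 * Real.pi))).exists_isMinOn
    (Set.nonempty_Icc.2 Real.two_pi_pos.le) isCompact_Icc
  refine ⟨φ₀, fun φ => ?_⟩
  obtain ⟨ψ, hψ, h⟩ := whichPhase_periodic.exists_mem_Ico₀ Real.two_pi_pos φ
  rw [h]
  exact hφ₀ (Set.Ico_subset_Icc_self hψ)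

end Uncertainty

end WPDR

end

theorem mainTheorem1 {E₁ E₂ : Type*} [Fintype E₁] [DecidableEq E₁] [Fintype E₂] [DecidableEq E₂]
    (ρ : Matrix (Fin 2 × E₁ × E₂) (Fin 2 × E₁ × E₂) ℂ) (hρ : WPDR.IsState ρ) :
    ∃ m : ℝ,
      IsLeast (Set.range fun φ : ℝ =>
        WPDR.hMax (WPDR.condStates (WPDR.whichPhase φ) (WPDR.traceE₁ ρ))) m ∧
      1 ≤ WPDR.hMin (WPDR.condStates WPDR.whichPath (WPDR.traceE₂ ρ)) + m := by
  obtain ⟨φ₀, hφ₀⟩ := WPDR.exists_forall_pSecr_le hρ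
  have hg := WPDR.pGuess_pos hρ
  have hs := WPDR.two_mul_pGuess_le_pSecr hρ.1 φ₀
  have hs0 : 0 < WPDR.pSecr (WPDR.condStates (WPDR.whichPhase φ₀) (WPDR.traceE₁ ρ)) := by linarith
  refine ⟨_, ⟨⟨φ₀, rfl⟩, ?_⟩, ?_⟩
  · rintro _ ⟨φ, rfl⟩
    exact Real.logb_le_logb_of_le one_lt_two hs0 (hφ₀ φ)
  · have h := Real.logb_le_logb_of_le one_lt_two (by positivity) hs
    rw [Real.logb_mul two_ne_zero hg.ne', Real.logb_self_eq_one one_lt_two] at h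
    simp only [WPDR.hMin, WPDR.hMax]
    linarith
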